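/- Let $X$ be a compact metric space with metric $d$ and let $T:X\to X$ be continuous. Let $\mathcal M_{\rm inv}$ be the set of $T$-invariant Borel probability measures on $X$, and for $\mu\in\mathcal M_{\rm inv}$ let $h_\mu\in[0,\infty]$ be its measure-theoretic (Kolmogorov–Sinai) entropy. For $Z\subset X$, let $h_{\rm top}(Z)\in[0,\infty]$ be Bowen's topological entropy of $Z$. It is defined as follows. Let $B_n(x,\epsilon)=\{y\in X: d(T^jx,T^jy)<\epsilon \text{ for } 0\le j<n\}$. For $s\ge 0$ and $\epsilon>0$, let $H^s_n(Z,\epsilon)=\inf\sum_i e^{-sn_i}$, the infimum being over all at most countable covers of $Z$ by balls $B_{n_i}(x_i,\epsilon)$ with all $n_i\ge n$, and let $H^s(Z,\epsilon)=\lim_{n\to\infty}H^s_n(Z,\epsilon)$. Let $h_{\rm top}(Z,\epsilon)=\inf\{s\ge0: H^s(Z,\epsilon)=0\}$ (with $\inf\emptyset=\infty$) and $h_{\rm top}(Z)=\lim_{\epsilon\to0}h_{\rm top}(Z,\epsilon)$. In particular $h_{\rm top}(\emptyset)=0$. Suppose that $(X,T)$ is saturated, that is, $h_{\rm top}(G_\mu)=h_\mu$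 for every $\mu\in\mathcal M_{\rm inv}$, where $G_\mu$ is the set of $x\in X$ for which $\frac1n\sum_{j=0}^{n-1}\delta_{T^jx}\to\mu$ in the weak star topology. Let $\mathbb B$ be a real Banach space and let its dual $\mathbb B^*$ carry the weak star topology $\sigma(\mathbb B^*,\mathbb B)$. Let $\Phi:X\to\mathbb B^*$ be continuous and put $A_n\Phi(x)=\frac1n\sum_{j=0}^{n-1}\Phi(T^jx)$ for $n\ge1$. For $\mu\in\mathcal M_{\rm inv}$ let $\int\Phi\,d\mu\in\mathbb B^*$ be the Pettis integral, $\langle\int\Phi\,d\mu,w\rangle=\int\langle\Phi,w\rangle\,d\mu$ for $w\in\mathbb B$. Let $Y$ be a topological space in which every sequence has at most one limit (for instance a Hausdorff space), let $\Psi$ be a continuous map into $Y$ from the closed convex hull of $\Phi(X)$ in $\mathbb B^*$, and let $\beta\in Y$. Set $$X_\Phi^\Psi(\beta)=\Bigl\{x\in X:\ \lim_{n\to\infty}\Psi(A_n\Phi(x))=\beta\Bigr\},$$ $$\widehat X_\Phi^\Psi(\beta)=\Bigl\{x\in X:\ \lim_{n\to\infty}A_n\Phi(x)\text{ exists and }\Psi\bigl(\lim_{n\to\infty}A_n\Phi(x)\bigr)=\beta\Bigr\},$$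 $$\mathcal M_\Phi^\Psi(\beta)=\Bigl\{\mu\in\mathcal M_{\rm inv}:\ \Psi\Bigl(\int\Phi\,d\mu\Bigr)=\beta\Bigr\}.$$ Then: 1. if $\mathcal M_\Phi^\Psi(\beta)=\emptyset$, then $X_\Phi^\Psi(\beta)=\emptyset$; 2. if $\mathcal M_\Phi^\Psi(\beta)\neq\emptyset$, then $$h_{\rm top}\bigl(X_\Phi^\Psi(\beta)\bigr)=h_{\rm top}\bigl(\widehat X_\Phi^\Psi(\beta)\bigr)=\sup_{\mu\in\mathcal M_\Phi^\Psi(\beta)}h_\mu .$$ -/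

import Mathlib

open MeasureTheory Filter Topology Set
open scoped ENNReal NNReal

noncomputable section

namespace SaturatedSystem

/-! ### Bowen's topological entropy of a subset -/

section TopologicalEntropy

variable {X : Type*} [MetricSpace X]

/-- The open ball `B_n(x, ε)` of the metric `d_n(x, y) = max_{0 ≤ j < n} d(T^j x, T^j y)`. -/
def bowenBall (T : X → X) (n : ℕ) (x : X) (ε : ℝ) : Set X :=
  {y | ∀ j < n, dist (T^[j] x) (T^[j] y) < ε}

/-- `C`, regarded as the collection of the balls `B_m(x, ε)` with `(m, x) ∈ C`, is an at most
countable cover of `Z` by Bowen balls of length at least `n`. -/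
def IsBowenCover (T : X → X) (Z : Set X) (ε : ℝ) (n : ℕ) (C : Set (ℕ × X)) : Prop :=
  C.Countable ∧ (∀ p ∈ C, n ≤ p.1) ∧ Z ⊆ ⋃ p ∈ C, bowenBall T p.1 p.2 ε

/-- `H^s_n(Z, ε)`: the infimum of `∑_i exp(-s n_i)` over the covers of `Z` by Bowen balls
`B_{n_i}(x_i, ε)` with all `n_i ≥ n`. -/
def bowenPreMeasure (T : X → X) (s : ℝ≥0) (n : ℕ) (Z : Set X) (ε : ℝ) : ℝ≥0∞ :=
  ⨅ (C : Set (ℕ × X)) (_ : IsBowenCover T Z ε n C),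
    ∑' p : C, ENNReal.ofReal (Real.exp (-(s : ℝ) * (p.1.1 : ℝ)))

/-- `H^s(Z, ε) = lim_n H^s_n(Z, ε)`; the sequence is non-decreasing in `n`, so that the limit is the
supremum. -/
def bowenMeasure (T : X → X) (s : ℝ≥0) (Z : Set X) (ε : ℝ) : ℝ≥0∞ :=
  ⨆ n : ℕ, bowenPreMeasure T s n Z ε

/-- The critical value `h_top(Z, ε) ∈ [0, ∞]` at which `s ↦ H^s(Z, ε)`, `s ≥ 0`, drops from `∞`
to `0`. -/
def topEntropyAt (T : X → X) (Z : Set X) (ε : ℝ) : ℝ≥0∞ :=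
  ⨅ (s : ℝ≥0) (_ : bowenMeasure T s Z ε = 0), (s : ℝ≥0∞)

/-- Bowen's topological entropy `h_top(Z) = lim_{ε → 0} h_top(Z, ε)`; as `h_top(Z, ε)` does not
decrease when `ε` decreases, the limit is the supremum over `ε > 0`. -/
def topEntropy (T : X → X) (Z : Set X) : ℝ≥0∞ :=
  ⨆ (ε : ℝ) (_ : 0 < ε), topEntropyAt T Z ε

end TopologicalEntropy

/-! ### Measure-theoretic (Kolmogorov–Sinai) entropy -/

section MeasureEntropy

variable {X : Type*} [MeasurableSpace X]

/-- The Shannon entropy of `⋁_{j < n} T^{-j} ξ`, where the finite partition `ξ` is given by its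
labelling map `ξ : X → Fin k`: the atoms of the join are indexed by words of length `n`. -/
def joinEntropy (T : X → X) (μ : Measure X) {k : ℕ} (ξ : X → Fin k) (n : ℕ) : ℝ :=
  ∑ w : Fin n → Fin k, Real.negMulLog (μ.real {x | ∀ j : Fin n, ξ (T^[(j : ℕ)] x) = w j})

/-- `h_μ(T, ξ) = lim_n (1/n) H_μ(⋁_{j < n} T^{-j} ξ)`. For an invariant `μ` the limit exists and is
therefore the upper limit. -/
def partitionEntropy (T : X → X) (μ : Measure X) {k : ℕ} (ξ : X → Fin k) : ℝ≥0∞ :=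
  limsup (fun n : ℕ => ENNReal.ofReal (joinEntropy T μ ξ n / n)) atTop

/-- The entropy `h_μ`: the supremum of `h_μ(T, ξ)` over all finite measurable partitions `ξ`. -/
def measureEntropy (T : X → X) (μ : Measure X) : ℝ≥0∞ :=
  ⨆ (k : ℕ) (ξ : X → Fin k) (_ : Measurable ξ), partitionEntropy T μ ξ

end MeasureEntropy

/-! ### Invariant measures, generic points, saturated systems -/

section Saturated

variable {X : Type*} [MetricSpace X] [MeasurableSpace X] [BorelSpace X]

/-- The set of all `T`-invariant Borel probability measures. -/
def invariantMeasures (T : X → X) : Set (ProbabilityMeasure X) :=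
  {μ | MeasurePreserving T (μ : Measure X) (μ : Measure X)}

/-- The empirical measure `(1/(n+1)) ∑_{j=0}^{n} δ_{T^j x}` (the index is shifted by one so that it
is a probability measure for every `n`). -/
def empiricalMeasure (T : X → X) (x : X) (n : ℕ) : ProbabilityMeasure X :=
  ⟨((n + 1 : ℕ) : ℝ≥0∞)⁻¹ • ∑ j ∈ Finset.range (n + 1), Measure.dirac (T^[j] x), ⟨by
    simp only [Measure.smul_apply, Measure.finsetSum_apply, measure_univ, Finset.sum_const,
      Finset.card_range, nsmul_eq_mul, mul_one, smul_eq_mul]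
    exact ENNReal.inv_mul_cancel (by simp) (ENNReal.natCast_ne_top _)⟩⟩

/-- The set `G_μ` of `μ`-generic points; the topology on `ProbabilityMeasure X` is that of weak
(weak star) convergence. -/
def genericPoints (T : X → X) (μ : ProbabilityMeasure X) : Set X :=
  {x | Tendsto (empiricalMeasure T x) atTop (𝓝 μ)}

/-- `(X, T)` is saturated: `h_top(G_μ) = h_μ` for every invariant `μ`. -/
def IsSaturated (T : X → X) : Prop :=
  ∀ μ ∈ invariantMeasures T, topEntropy T (genericPoints T μ) = measureEntropy T (μ : Measure X)

end Saturated

/-! ### The Pettis integral of a weak star continuous function -/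

section Pettis

variable {X : Type*} [MetricSpace X]
  {B : Type*} [NormedAddCommGroup B] [NormedSpace ℝ B]

theorem continuous_pairing {Φ : X → WeakDual ℝ B} (hΦ : Continuous Φ) (w : B) :
    Continuous fun x => Φ x w :=
  (WeakDual.eval_continuous w).comp hΦ

variable [CompactSpace X]

theorem exists_pairing_bound [CompleteSpace B] {Φ : X → WeakDual ℝ B} (hΦ : Continuous Φ) :
    ∃ C : ℝ, ∀ x w, ‖Φ x w‖ ≤ C * ‖w‖ := by
  obtain ⟨C, hC⟩ := banach_steinhaus (g := fun x => WeakDual.toStrongDual (Φ x)) (fun w => by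
    obtain ⟨K, hK⟩ := (isCompact_range (continuous_pairing hΦ w)).isBounded.exists_norm_le
    exact ⟨K, fun x => hK _ ⟨x, rfl⟩⟩)
  exact ⟨C, fun x w => ((WeakDual.toStrongDual (Φ x)).le_opNorm w).trans
    (mul_le_mul_of_nonneg_right (hC x) (norm_nonneg w))⟩

variable [MeasurableSpace X] [BorelSpace X]

theorem integrable_pairing {Φ : X → WeakDual ℝ B} (hΦ : Continuous Φ)
    (μ : ProbabilityMeasure X) (w : B) : Integrable (fun x => Φ x w) (μ : Measure X) :=
  (continuous_pairing hΦ w).integrable_of_hasCompactSupport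
    (HasCompactSupport.of_compactSpace _)

/-- The Pettis integral `∫ Φ dμ ∈ B*`, that is, the functional `w ↦ ∫ ⟨Φ, w⟩ dμ`. -/
def pettisIntegral [CompleteSpace B] {Φ : X → WeakDual ℝ B} (hΦ : Continuous Φ)
    (μ : ProbabilityMeasure X) : WeakDual ℝ B :=
  StrongDual.toWeakDual <| LinearMap.mkContinuousOfExistsBound
    { toFun := fun w => ∫ x, Φ x w ∂(μ : Measure X)
      map_add' := fun v w => by
        simp only [map_add]
        exact integral_add (integrable_pairing hΦ μ v) (integrable_pairing hΦ μ w)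
      map_smul' := fun c w => by
        simp only [map_smul, smul_eq_mul, RingHom.id_apply]
        exact integral_const_mul c _ }
    (by
      obtain ⟨C, hC⟩ := exists_pairing_bound hΦ
      refine ⟨C, fun w => ?_⟩
      have h := norm_integral_le_of_norm_le_const (μ := (μ : Measure X))
        (Eventually.of_forall fun x => hC x w)
      simpa using h)

theorem pettisIntegral_apply [CompleteSpace B] {Φ : X → WeakDual ℝ B} (hΦ : Continuous Φ)
    (μ : ProbabilityMeasure X) (w : B) :
    pettisIntegral hΦ μ w = ∫ x, Φ x w ∂(μ : Measure X) := rfl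

end Pettis

/-! ### Level sets -/

section LevelSets

variable {X : Type*} [MetricSpace X] {B : Type*} [NormedAddCommGroup B] [NormedSpace ℝ B]
  {Y : Type*}

/-- The set of `x` with `lim_n Ψ(A_n Φ(x)) = β`, where `A_n Φ(x) = (1/n) ∑_{j<n} Φ(T^j x)`. -/
def levelSet [TopologicalSpace Y] (T : X → X) (Φ : X → WeakDual ℝ B) (Ψ : WeakDual ℝ B → Y)
    (β : Y) : Set X :=
  {x | Tendsto (fun n : ℕ => Ψ (birkhoffAverage ℝ T Φ n x)) atTop (𝓝 β)}

/-- The set of `x` for which `A_n Φ(x)` converges in the weak star topology, with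
`Ψ(lim_n A_n Φ(x)) = β`. -/
def limitLevelSet (T : X → X) (Φ : X → WeakDual ℝ B) (Ψ : WeakDual ℝ B → Y) (β : Y) : Set X :=
  {x | ∃ α : WeakDual ℝ B,
    Tendsto (fun n : ℕ => birkhoffAverage ℝ T Φ n x) atTop (𝓝 α) ∧ Ψ α = β}

/-- The set of invariant probability measures `μ` with `Ψ(∫ Φ dμ) = β`. -/
def measureLevelSet [CompactSpace X] [MeasurableSpace X] [BorelSpace X] [CompleteSpace B]
    (T : X → X) {Φ : X → WeakDual ℝ B} (hΦ : Continuous Φ) (Ψ : WeakDual ℝ B → Y) (β : Y) :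
    Set (ProbabilityMeasure X) :=
  {μ | μ ∈ invariantMeasures T ∧ Ψ (pettisIntegral hΦ μ) = β}

end LevelSets

end SaturatedSystem

end

noncomputable section

namespace SaturatedSystem

/-! ### Null sets of Bowen's outer measures -/

section Covers

variable {X : Type*} [MetricSpace X] {T : X → X}

/-! Lower bound: if `μ` lies in the measure level set, its generic points lie in the limit level
set, so saturation and monotonicity of `topEntropy` give the supremum; continuity of `Ψ` on the hull
puts the limit level set inside the level set.

Upper bound: by compactness the empirical measures of a point of the level set accumulate at some
invariant `μ`. Along that subsequence the averages tend to `∫ Φ dμ`, so uniqueness of limits in `Y`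
forces `Ψ (∫ Φ dμ) = β` (`exists_mem_measureLevelSet_mapClusterPt`). This also settles the empty
case. What remains is Bowen's bound `topEntropy_le_of_mapClusterPt`, which rests on the local
estimate `exists_nhds_cover`: if `h_μ < a`, the mean information of words of one fixed length `m`,
measured by a positive vector `q`, is continuous at `μ` and less than `m a` there, and orbits with
small mean information are few. Countably many such neighbourhoods suffice, and a Borel–Cantelli
argument finishes each. -/

theorem bowenPreMeasure_le {s : ℝ≥0} {n : ℕ} {Z : Set X} {ε : ℝ} {C : Set (ℕ × X)}
    (hC : IsBowenCover T Z ε n C) :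
    bowenPreMeasure T s n Z ε ≤ ∑' p : C, ENNReal.ofReal (Real.exp (-(s : ℝ) * (p.1.1 : ℝ))) :=
  iInf₂_le C hC

theorem bowenPreMeasure_mono_set {s : ℝ≥0} {n : ℕ} {Z Z' : Set X} {ε : ℝ} (h : Z ⊆ Z') :
    bowenPreMeasure T s n Z ε ≤ bowenPreMeasure T s n Z' ε :=
  le_iInf₂ fun _ hC => bowenPreMeasure_le ⟨hC.1, hC.2.1, h.trans hC.2.2⟩

theorem bowenPreMeasure_mono_length {s : ℝ≥0} {n n' : ℕ} {Z : Set X} {ε : ℝ} (h : n ≤ n') :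
    bowenPreMeasure T s n Z ε ≤ bowenPreMeasure T s n' Z ε :=
  le_iInf₂ fun _ hC => bowenPreMeasure_le ⟨hC.1, fun p hp => h.trans (hC.2.1 p hp), hC.2.2⟩

theorem bowenMeasure_mono_set {s : ℝ≥0} {Z Z' : Set X} {ε : ℝ} (h : Z ⊆ Z') :
    bowenMeasure T s Z ε ≤ bowenMeasure T s Z' ε :=
  iSup_mono fun _ => bowenPreMeasure_mono_set h

theorem topEntropy_mono {Z Z' : Set X} (h : Z ⊆ Z') : topEntropy T Z ≤ topEntropy T Z' :=
  iSup₂_mono fun _ _ => le_iInf₂ fun s hs =>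
    iInf₂_le (f := fun (s : ℝ≥0) _ => (s : ℝ≥0∞)) s
      (le_antisymm ((bowenMeasure_mono_set h).trans hs.le) zero_le)

/-- A countable union of `H^s(·, ε)`-null sets is `H^s(·, ε)`-null. -/
theorem bowenMeasure_iUnion_eq_zero {ι : Type*} [Countable ι] {s : ℝ≥0} {Z : ι → Set X} {ε : ℝ}
    (h : ∀ i, bowenMeasure T s (Z i) ε = 0) : bowenMeasure T s (⋃ i, Z i) ε = 0 := by
  refine le_antisymm (iSup_le fun n => ?_) zero_le
  refine ENNReal.le_of_forall_pos_le_add fun η hη _ => ?_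
  obtain ⟨δ, hδ, hδη⟩ := ENNReal.exists_pos_sum_of_countable
    (ENNReal.coe_pos.2 hη).ne' ι
  have hcov : ∀ i, ∃ C, IsBowenCover T (Z i) ε n C ∧
      ∑' p : C, ENNReal.ofReal (Real.exp (-(s : ℝ) * (p.1.1 : ℝ))) < δ i := fun i => by
    have h0 : bowenPreMeasure T s n (Z i) ε < δ i :=
      ((le_iSup (fun n => bowenPreMeasure T s n (Z i) ε) n).trans (h i).le).trans_lt
        (ENNReal.coe_pos.2 (hδ i))
    simpa only [bowenPreMeasure, iInf_lt_iff, exists_prop] using h0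
  choose C hC hCδ using hcov
  have hU : IsBowenCover T (⋃ i, Z i) ε n (⋃ i, C i) := by
    refine ⟨countable_iUnion fun i => (hC i).1, fun p hp => ?_, iUnion_subset fun i x hx => ?_⟩
    · obtain ⟨i, hi⟩ := mem_iUnion.1 hp
      exact (hC i).2.1 p hi
    · obtain ⟨p, hp, hxp⟩ := mem_iUnion₂.1 ((hC i).2.2 hx)
      exact mem_iUnion₂.2 ⟨p, mem_iUnion.2 ⟨i, hp⟩, hxp⟩
  calc bowenPreMeasure T s n (⋃ i, Z i) ε ≤ _ := bowenPreMeasure_le hU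
    _ ≤ ∑' i, ∑' p : C i, ENNReal.ofReal (Real.exp (-(s : ℝ) * (p.1.1 : ℝ))) :=
        ENNReal.tsum_iUnion_le_tsum
          (fun p : ℕ × X => ENNReal.ofReal (Real.exp (-(s : ℝ) * (p.1 : ℝ)))) C
    _ ≤ ∑' i, (δ i : ℝ≥0∞) := ENNReal.tsum_le_tsum fun i => (hCδ i).le
    _ ≤ 0 + η := by simpa using hδη.le

/-- If `V n` is covered by at most `K exp(a (n + 1))` balls of length `n + 1`, then the points lying
in infinitely many `V n` form an `H^s`-null set for `s > a`. -/
theorem bowenMeasure_frequently_eq_zero {s : ℝ≥0} {ε a K : ℝ} (has : a < s) {V : ℕ → Set X}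
    (hV : ∀ n, ∃ F : Finset X, V n ⊆ (⋃ x ∈ F, bowenBall T (n + 1) x ε) ∧
      (F.card : ℝ) ≤ K * Real.exp (a * ((n + 1 : ℕ) : ℝ))) :
    bowenMeasure T s {x | ∃ᶠ n in atTop, x ∈ V n} ε = 0 := by
  choose F hF hcard using hV
  set Z := {x | ∃ᶠ n in atTop, x ∈ V n}
  let D : ℕ → Set (ℕ × X) := fun n => (fun x => (n + 1, x)) '' (F n : Set X)
  let g : ℕ → ℝ≥0∞ := fun n => ENNReal.ofReal (K * Real.exp (a - s) ^ (n + 1))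
  have hK : 0 ≤ K := by
    by_contra hK
    have := (hcard 0).trans_lt (mul_neg_of_neg_of_pos (not_le.1 hK) (Real.exp_pos _))
    exact absurd this (not_lt.2 (Nat.cast_nonneg _))
  have hD : ∀ n, ∑' p : D n, ENNReal.ofReal (Real.exp (-(s : ℝ) * (p.1.1 : ℝ))) ≤ g n := by
    intro n
    have hinj : InjOn (fun x : X => (n + 1, x)) (F n : Set X) := fun x _ y _ h => by
      simpa using h
    rw [tsum_image (fun p : ℕ × X => ENNReal.ofReal (Real.exp (-(s : ℝ) * (p.1 : ℝ)))) hinj]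
    simp only [Finset.coe_sort_coe, tsum_fintype, Finset.sum_const, nsmul_eq_mul,
      Finset.card_univ, Fintype.card_coe]
    rw [← ENNReal.ofReal_natCast, ← ENNReal.ofReal_mul (Nat.cast_nonneg _)]
    refine ENNReal.ofReal_le_ofReal ?_
    refine (mul_le_mul_of_nonneg_right (hcard n) (Real.exp_pos _).le).trans_eq ?_
    rw [mul_assoc, ← Real.exp_add, ← Real.exp_nat_mul]
    ring_nf
  have hg : ∑' n, g n ≠ ∞ := by
    have hlt : Real.exp (a - s) < 1 := Real.exp_lt_one_iff.2 (by linarith)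
    have hs : Summable fun n : ℕ => K * Real.exp (a - s) ^ (n + 1) :=
      ((summable_nat_add_iff 1).2
        (summable_geometric_of_lt_one (Real.exp_pos _).le hlt)).mul_left K
    exact hs.tsum_ofReal_ne_top
  have hle : ∀ N, bowenPreMeasure T s N Z ε ≤ ∑' n, g (n + N) := by
    intro N
    have hcov : IsBowenCover T Z ε N (⋃ n, D (n + N)) := by
      refine ⟨countable_iUnion fun n => ((F (n + N)).finite_toSet.image _).countable, ?_, ?_⟩
      · intro p hp
        obtain ⟨n, x, _, rfl⟩ := mem_iUnion.1 hp
        change N ≤ n + N + 1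
        omega
      · intro x hx
        obtain ⟨n, hn, hxn⟩ := (frequently_atTop.1 hx) N
        obtain ⟨y, hy, hxy⟩ := mem_iUnion₂.1 (hF n hxn)
        refine mem_iUnion₂.2 ⟨(n + 1, y), mem_iUnion.2 ⟨n - N, ?_⟩, hxy⟩
        rw [Nat.sub_add_cancel hn]
        exact ⟨y, hy, rfl⟩
    exact (bowenPreMeasure_le hcov).trans ((ENNReal.tsum_iUnion_le_tsum
      (fun p : ℕ × X => ENNReal.ofReal (Real.exp (-(s : ℝ) * (p.1 : ℝ)))) _).trans
        (ENNReal.tsum_le_tsum fun n => hD _))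
  -- Borel–Cantelli: the premeasure at `N` is at most that at every `M ≥ N`, hence at most the tails
  -- of a convergent series.
  refine le_antisymm (iSup_le fun N => ?_) zero_le
  refine ge_of_tendsto (ENNReal.tendsto_sum_nat_add g hg) ?_
  filter_upwards [eventually_ge_atTop N] with M hM
  exact (bowenPreMeasure_mono_length hM).trans (hle M)

end Covers

/-! ### Counting orbits of small information -/

section Counting

/-- Sorting times by residue mod `m` lets a pigeonhole argument select one phase `r` whose disjoint
blocks carry at most the average information. -/
theorem sum_range_residues (f : ℕ → ℝ) (m L : ℕ) :
    ∑ r ∈ Finset.range m, ∑ i ∈ Finset.range L, f (r + i * m) =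
      ∑ j ∈ Finset.range (L * m), f j := by
  induction L with
  | zero => simp
  | succ L ih =>
    simp only [Finset.sum_range_succ, Finset.sum_add_distrib, ih, Nat.succ_mul,
      Finset.sum_range_add]
    simp only [add_comm]

/-- The word of length `m` read off along the orbit of `x`. -/
def orbitWord {X : Type*} (T : X → X) {k : ℕ} (ξ : X → Fin k) (m : ℕ) (x : X) : Fin m → Fin k :=
  fun j => ξ (T^[(j : ℕ)] x)

/-- Two points with the same words at times `0`, `L m` and `r + i m`, `i < L`, have the same labels
up to time `(L + 1) m`. -/
theorem label_eq_of_words_eq {X : Type*} {T : X → X} {k : ℕ} {ξ : X → Fin k} {m L r : ℕ}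
    (hr : r < m) {x y : X} (h0 : orbitWord T ξ m x = orbitWord T ξ m y)
    (h1 : orbitWord T ξ m (T^[L * m] x) = orbitWord T ξ m (T^[L * m] y))
    (hb : ∀ i < L, orbitWord T ξ m (T^[r + i * m] x) = orbitWord T ξ m (T^[r + i * m] y))
    {j : ℕ} (hj : j < (L + 1) * m) : ξ (T^[j] x) = ξ (T^[j] y) := by
  have key : ∀ t, orbitWord T ξ m (T^[t] x) = orbitWord T ξ m (T^[t] y) → t ≤ j → j < t + m →
      ξ (T^[j] x) = ξ (T^[j] y) := by
    intro t ht h1 h2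
    have := congrFun ht ⟨j - t, by omega⟩
    simpa only [orbitWord, ← Function.iterate_add_apply, Nat.sub_add_cancel h1] using this
  rcases lt_or_ge j m with hjm | hjm
  · exact key 0 h0 (Nat.zero_le _) (by omega)
  rcases le_or_gt (L * m) j with hjL | hjL
  · exact key _ h1 hjL (by linarith)
  -- Here `r < m ≤ j < L * m`, so `j` lies in the block of index `(j - r) / m < L`.
  · have hdiv := Nat.div_add_mod (j - r) m
    have hmod := Nat.mod_lt (j - r) (by omega : 0 < m)
    rw [mul_comm] at hdiv
    refine key (r + (j - r) / m * m) (hb _ ?_) (by omega) (by omega)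
    exact (Nat.div_lt_iff_lt_mul (by omega)).2 (by omega)

/-- A set each of whose points carries a code in `G`, points with a common code being related by
`R`, is covered by the `R`-classes of at most `#G` points. -/
theorem exists_finset_of_code {X ι : Type*} {V : Set X} (G : Finset ι) (code : X → ι → Prop)
    (R : X → Set X) (hV : ∀ x ∈ V, ∃ c ∈ G, code x c)
    (hR : ∀ x y c, code x c → code y c → y ∈ R x) :
    ∃ F : Finset X, V ⊆ (⋃ x ∈ F, R x) ∧ F.card ≤ G.card := by
  classical
  rcases isEmpty_or_nonempty X with hX | hX
  · exact ⟨∅, fun x => (hX.false x).elim, by simp⟩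
  -- Codes carried by no point receive an arbitrary one, which only enlarges `F`.
  let pick : ι → X := fun c => Classical.epsilon fun x => code x c
  refine ⟨G.image pick, fun y hy => ?_, Finset.card_image_le⟩
  obtain ⟨c, hc, hyc⟩ := hV y hy
  exact mem_iUnion₂.2 ⟨pick c, Finset.mem_image_of_mem _ hc,
    hR _ _ c (Classical.epsilon_spec (p := fun x => code x c) ⟨y, hyc⟩) hyc⟩

/-- For a probability vector `q` on a finite alphabet, the number of words of `q`-probability at
least `exp(-t)` is at most `exp t`. -/
theorem card_filter_exp_neg_le_prod {W : Type*} [Fintype W] {q : W → ℝ} (hq0 : ∀ w, 0 < q w)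
    (hq1 : ∑ w, q w = 1) (L : ℕ) (t : ℝ) :
    ((Finset.univ.filter fun b : Fin L → W => Real.exp (-t) ≤ ∏ i, q (b i)).card : ℝ) ≤
      Real.exp t := by
  classical
  have h2 : ∑ b : Fin L → W, ∏ i, q (b i) = 1 := by
    rw [← Fintype.prod_sum fun (_ : Fin L) w => q w]
    simp [hq1]
  set G := Finset.univ.filter fun b : Fin L → W => Real.exp (-t) ≤ ∏ i, q (b i)
  have h1 : (G.card : ℝ) * Real.exp (-t) ≤ 1 := by
    calc (G.card : ℝ) * Real.exp (-t) = ∑ b ∈ G, Real.exp (-t) := by simp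
      _ ≤ ∑ b ∈ G, ∏ i, q (b i) := Finset.sum_le_sum fun c hc => (Finset.mem_filter.1 hc).2
      _ ≤ ∑ b : Fin L → W, ∏ i, q (b i) := Finset.sum_le_univ_sum_of_nonneg
          fun c => Finset.prod_nonneg fun i _ => (hq0 _).le
      _ = 1 := h2
  rw [Real.exp_neg, ← div_eq_mul_inv, div_le_iff₀ (Real.exp_pos _), one_mul] at h1
  exact h1

/-- Points whose orbit up to time `n` has `q`-information at most `n m a` are covered by at most
`m k^{2m} exp(a n)` balls of length `n`. -/
theorem exists_cover_of_information_le {X : Type*} [MetricSpace X] {T : X → X} {k m : ℕ}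
    (hm : 0 < m) {ξ : X → Fin k} {ε : ℝ} (hξ : ∀ x y, ξ x = ξ y → dist x y < ε)
    {q : (Fin m → Fin k) → ℝ} (hq0 : ∀ w, 0 < q w) (hq1 : ∑ w, q w = 1) (a : ℝ) (n : ℕ) :
    ∃ F : Finset X,
      {x | ∑ j ∈ Finset.range n, -Real.log (q (orbitWord T ξ m (T^[j] x))) ≤ n * (m * a)} ⊆
        (⋃ x ∈ F, bowenBall T n x ε) ∧
      (F.card : ℝ) ≤ (m * ((k : ℝ) ^ m * (k : ℝ) ^ m)) * Real.exp (a * n) := by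
  classical
  set L := n / m
  have hLn : L * m ≤ n := Nat.div_mul_le_self n m
  have hnL : n < (L + 1) * m := (Nat.div_lt_iff_lt_mul hm).1 (Nat.lt_succ_self _)
  -- A code consists of a phase `r`, the words at times `0` and `L * m`, which fill the gaps at both
  -- ends, and the `L` words in between. Only the latter are numerous, and `q` bounds their number.
  let G₀ : Finset (Fin L → Fin m → Fin k) :=
    Finset.univ.filter fun b => Real.exp (-(a * n)) ≤ ∏ i, q (b i)
  let G : Finset (Fin m × ((Fin m → Fin k) × (Fin m → Fin k)) × (Fin L → Fin m → Fin k)) :=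
    Finset.univ ×ˢ Finset.univ ×ˢ G₀
  have hG : (G.card : ℝ) ≤ (m * ((k : ℝ) ^ m * (k : ℝ) ^ m)) * Real.exp (a * n) := by
    have h : (G.card : ℝ) = (m * ((k : ℝ) ^ m * (k : ℝ) ^ m)) * G₀.card := by
      simp only [G, Finset.card_product, Finset.card_univ, Fintype.card_prod, Fintype.card_fun,
        Fintype.card_fin]
      push_cast
      ring
    rw [h]
    exact mul_le_mul_of_nonneg_left (card_filter_exp_neg_le_prod hq0 hq1 L _) (by positivity)
  suffices h : ∃ F : Finset X,
      {x | ∑ j ∈ Finset.range n, -Real.log (q (orbitWord T ξ m (T^[j] x))) ≤ n * (m * a)} ⊆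
        (⋃ x ∈ F, bowenBall T n x ε) ∧ F.card ≤ G.card by
    obtain ⟨F, hF, hcard⟩ := h
    exact ⟨F, hF, (Nat.cast_le.2 hcard).trans hG⟩
  refine exists_finset_of_code G
    (fun x c => orbitWord T ξ m x = c.2.1.1 ∧ orbitWord T ξ m (T^[L * m] x) = c.2.1.2 ∧
      ∀ i : Fin L, orbitWord T ξ m (T^[(c.1 : ℕ) + i * m] x) = c.2.2 i)
    (fun x => bowenBall T n x ε) ?_ ?_
  · intro x hx
    set f : ℕ → ℝ := fun j => -Real.log (q (orbitWord T ξ m (T^[j] x)))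
    -- Nonnegativity allows the times from `L * m` to `n` to be dropped.
    have hf : ∀ j, 0 ≤ f j := fun j => neg_nonneg.2 <| Real.log_nonpos (hq0 _).le <|
      hq1 ▸ Finset.single_le_sum (fun w _ => (hq0 w).le) (Finset.mem_univ _)
    have hsum : ∑ r ∈ Finset.range m, ∑ i ∈ Finset.range L, f (r + i * m) ≤
        ∑ r ∈ Finset.range m, n * a := by
      rw [sum_range_residues]
      refine (Finset.sum_le_sum_of_subset_of_nonneg (Finset.range_mono hLn)
        fun j _ _ => hf j).trans (le_trans hx (le_of_eq ?_))
      simp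
      ring
    obtain ⟨r, hr, hrle⟩ := Finset.exists_le_of_sum_le
      (Finset.nonempty_range_iff.2 hm.ne') hsum
    rw [Finset.mem_range] at hr
    refine ⟨(⟨r, hr⟩, (orbitWord T ξ m x, orbitWord T ξ m (T^[L * m] x)),
      fun i => orbitWord T ξ m (T^[r + i * m] x)), ?_, rfl, rfl, fun i => rfl⟩
    refine Finset.mem_product.2 ⟨Finset.mem_univ _, Finset.mem_product.2 ⟨Finset.mem_univ _,
      Finset.mem_filter.2 ⟨Finset.mem_univ _, ?_⟩⟩⟩
    rw [← Real.le_log_iff_exp_le (Finset.prod_pos fun i _ => hq0 _),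
      Real.log_prod fun i _ => (hq0 _).ne']
    rw [Finset.sum_range] at hrle
    simp only [f, Finset.sum_neg_distrib] at hrle
    linarith
  · rintro x y ⟨r, ⟨u, v⟩, b⟩ ⟨hx0, hx1, hxb⟩ ⟨hy0, hy1, hyb⟩ j hj
    refine hξ _ _ (label_eq_of_words_eq (m := m) (L := L) r.2 (hx0.trans hy0.symm)
      (hx1.trans hy1.symm) (fun i hi => ?_) (hj.trans hnL))
    exact (hxb ⟨i, hi⟩).trans (hyb ⟨i, hi⟩).symm

end Counting

/-! ### Bowen's upper bound through neighbourhoods of invariant measures -/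

section LocalEstimate

theorem frontier_iInter_subset {X ι : Type*} [TopologicalSpace X] [Finite ι] (s : ι → Set X) :
    frontier (⋂ i, s i) ⊆ ⋃ i, frontier (s i) := by
  intro x hx
  rw [frontier, interior_iInter_of_finite] at hx
  obtain ⟨i, hi⟩ : ∃ i, x ∉ interior (s i) := by simpa using hx.2
  exact mem_iUnion.2 ⟨i, closure_mono (iInter_subset s i) hx.1, hi⟩

/-- There is a finite measurable partition into sets of small diameter with `μ`-null boundary. -/
theorem exists_partition_null_frontier {X : Type*} [MetricSpace X] [CompactSpace X]
    [MeasurableSpace X] [BorelSpace X] (μ : Measure X) [IsProbabilityMeasure μ] {ε : ℝ}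
    (hε : 0 < ε) : ∃ (k : ℕ) (ξ : X → Fin k), Measurable ξ ∧ (∀ x y, ξ x = ξ y → dist x y < ε) ∧
      ∀ i, μ (frontier (ξ ⁻¹' {i})) = 0 := by
  classical
  choose r hr hμr using fun x : X => exists_null_frontier_thickening μ {x} (half_pos hε)
  simp only [Metric.thickening_singleton] at hμr
  obtain ⟨t, ht⟩ := isCompact_univ.elim_finite_subcover (fun x => Metric.ball x (r x))
    (fun x => Metric.isOpen_ball)
    (fun x _ => mem_iUnion.2 ⟨x, Metric.mem_ball_self (hr x).1⟩)
  let e := Fintype.equivFin (t → Bool)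
  -- The label records which balls of the cover contain `x`; equal labels force a common ball of
  -- radius less than `ε / 2`.
  let ζ : X → t → Bool := fun x i => decide (x ∈ Metric.ball (i : X) (r i))
  let piece : (t → Bool) → t → Set X := fun b i =>
    if b i then Metric.ball (i : X) (r i) else (Metric.ball (i : X) (r i))ᶜ
  have hpre : ∀ j, (fun x => e (ζ x)) ⁻¹' {j} = ⋂ i, piece (e.symm j) i := by
    intro j
    ext x
    simp only [mem_preimage, mem_singleton_iff, mem_iInter, ← Equiv.eq_symm_apply, funext_iff]
    refine forall_congr' fun i => ?_
    simp only [ζ, piece]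
    cases e.symm j i <;> simp
  refine ⟨_, fun x => e (ζ x), ?_, ?_, ?_⟩
  · refine measurable_to_countable' fun j => ?_
    rw [hpre]
    refine MeasurableSet.iInter fun i => ?_
    simp only [piece]
    split_ifs
    exacts [measurableSet_ball, measurableSet_ball.compl]
  · intro x y hxy
    obtain ⟨c, hc, hxc⟩ := mem_iUnion₂.1 (ht (mem_univ x))
    have h := congrFun (e.injective hxy) ⟨c, hc⟩
    have hyc : y ∈ Metric.ball c (r c) := by
      simpa [ζ, Metric.mem_ball.1 hxc] using h
    have h1 := Metric.mem_ball.1 hxc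
    have h2 := Metric.mem_ball.1 hyc
    have h3 := (hr c).2
    have h4 := dist_triangle_right x y c
    linarith
  · intro j
    rw [hpre]
    refine measure_mono_null (frontier_iInter_subset _) (measure_iUnion_null fun i => ?_)
    simp only [piece]
    split_ifs
    exacts [hμr _, by rw [frontier_compl]; exact hμr _]

/-- The Shannon entropy of `p` is approximated from above by the cross entropy of `p` with respect
to a strictly positive probability vector. -/
theorem exists_pos_crossEntropy_lt {W : Type*} [Fintype W] {p : W → ℝ}
    (hp0 : ∀ w, 0 ≤ p w) (hp1 : ∑ w, p w = 1) {c : ℝ} (hc : ∑ w, Real.negMulLog (p w) < c) :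
    ∃ q : W → ℝ, (∀ w, 0 < q w) ∧ ∑ w, q w = 1 ∧ ∑ w, p w * -Real.log (q w) < c := by
  set H := ∑ w, Real.negMulLog (p w)
  set N : ℝ := (Fintype.card W : ℝ)
  have hN : 0 ≤ N := Nat.cast_nonneg _
  -- Adding `η` to each `p w` and renormalizing costs at most `log (1 + N * η) ≤ N * η`.
  obtain ⟨η, hη, hηc⟩ : ∃ η : ℝ, 0 < η ∧ N * η < c - H := by
    refine ⟨(c - H) / (N + 1), div_pos (by linarith) (by linarith), ?_⟩
    rw [← mul_div_assoc, div_lt_iff₀ (by linarith)]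
    nlinarith
  have hD : 0 < 1 + N * η := by positivity
  refine ⟨fun w => (p w + η) / (1 + N * η), fun w => div_pos (by linarith [hp0 w]) hD, ?_, ?_⟩
  · rw [← Finset.sum_div, Finset.sum_add_distrib, hp1]
    simp only [Finset.sum_const, Finset.card_univ, nsmul_eq_mul]
    exact div_self hD.ne'
  · calc ∑ w, p w * -Real.log ((p w + η) / (1 + N * η))
        ≤ ∑ w, (Real.negMulLog (p w) + p w * (N * η)) := by
          refine Finset.sum_le_sum fun w _ => ?_
          rcases (hp0 w).eq_or_lt with h0 | h0
          · simp [← h0]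
          · rw [Real.log_div (by linarith) hD.ne', Real.negMulLog]
            have h1 : Real.log (p w) ≤ Real.log (p w + η) := Real.log_le_log h0 (by linarith)
            have h2 : Real.log (1 + N * η) ≤ N * η := by
              linarith [Real.log_le_sub_one_of_pos hD]
            nlinarith
      _ = H + N * η := by rw [Finset.sum_add_distrib, ← Finset.sum_mul, hp1, one_mul]
      _ < c := by linarith

theorem empiricalMeasure_real {X : Type*} [MeasurableSpace X] {T : X → X} (x : X)
    (n : ℕ) {A : Set X} (hA : MeasurableSet A) :
    (empiricalMeasure T x n : Measure X).real A =
      ((n + 1 : ℕ) : ℝ)⁻¹ * ∑ j ∈ Finset.range (n + 1), A.indicator 1 (T^[j] x) := by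
  change (((n + 1 : ℕ) : ℝ≥0∞)⁻¹ • ∑ j ∈ Finset.range (n + 1), Measure.dirac (T^[j] x)).real A = _
  rw [measureReal_def, Measure.smul_apply, Measure.finsetSum_apply, smul_eq_mul,
    ENNReal.toReal_mul, ENNReal.toReal_inv, ENNReal.toReal_natCast,
    ENNReal.toReal_sum fun j _ => measure_ne_top _ _]
  congr 1
  refine Finset.sum_congr rfl fun j _ => ?_
  rw [Measure.dirac_apply' _ hA]
  by_cases h : T^[j] x ∈ A <;> simp [h]

theorem preimage_orbitWord {X : Type*} {T : X → X} {k : ℕ} (ξ : X → Fin k) {m : ℕ}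
    (w : Fin m → Fin k) :
    orbitWord T ξ m ⁻¹' {w} = ⋂ j : Fin m, T^[(j : ℕ)] ⁻¹' (ξ ⁻¹' {w j}) := by
  ext x
  simp [orbitWord, funext_iff]

variable {X : Type*} [MetricSpace X] [MeasurableSpace X] [BorelSpace X] {T : X → X}

/-- Near an invariant measure of entropy less than `a`, the orbits of length `n + 1` with empirical
measure close to `μ` are covered by `O(exp(a (n + 1)))` balls of length `n + 1`. -/
theorem exists_nhds_cover [CompactSpace X] (hT : Continuous T) {μ : ProbabilityMeasure X}
    (hμ : μ ∈ invariantMeasures T) {a : ℝ≥0} (ha : measureEntropy T (μ : Measure X) < a)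
    {ε : ℝ} (hε : 0 < ε) :
    ∃ U ∈ 𝓝 μ, ∃ K : ℝ, ∀ n, ∃ F : Finset X,
      {x | empiricalMeasure T x n ∈ U} ⊆ (⋃ x ∈ F, bowenBall T (n + 1) x ε) ∧
      (F.card : ℝ) ≤ K * Real.exp (a * ((n + 1 : ℕ) : ℝ)) := by
  obtain ⟨k, ξ, hξm, hξd, hξf⟩ := exists_partition_null_frontier (μ : Measure X) hε
  obtain ⟨m, hmH, hm⟩ : ∃ m : ℕ, ENNReal.ofReal (joinEntropy T μ ξ m / m) < a ∧ 0 < m := by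
    have h : partitionEntropy T (μ : Measure X) ξ < a :=
      lt_of_le_of_lt (le_iSup_of_le k
        (le_iSup₂_of_le (f := fun ξ _ => partitionEntropy T μ ξ) ξ hξm le_rfl)) ha
    exact ((eventually_lt_of_limsup_lt h).and (eventually_gt_atTop 0)).exists
  have hm' : (0 : ℝ) < m := Nat.cast_pos.2 hm
  let A : (Fin m → Fin k) → Set X := fun w => orbitWord T ξ m ⁻¹' {w}
  have hAm : ∀ w, MeasurableSet (A w) := fun w => by
    simp only [A, preimage_orbitWord]
    exact MeasurableSet.iInter fun j =>
      (hT.iterate _).measurable (hξm (measurableSet_singleton _))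
  have hAf : ∀ w, (μ : Measure X) (frontier (A w)) = 0 := fun w => by
    simp only [A, preimage_orbitWord]
    refine measure_mono_null (frontier_iInter_subset _) (measure_iUnion_null fun j => ?_)
    refine measure_mono_null ((hT.iterate _).frontier_preimage_subset _) ?_
    rw [(MeasurePreserving.iterate hμ _).measure_preimage
      isClosed_frontier.measurableSet.nullMeasurableSet]
    exact hξf _
  have hjoin : ∑ w, Real.negMulLog ((μ : Measure X).real (A w)) < m * a := by
    have hset : ∀ w, A w = {x | ∀ j : Fin m, ξ (T^[(j : ℕ)] x) = w j} := fun w => by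
      ext x
      simp [A, orbitWord, funext_iff]
    simp only [hset]
    change joinEntropy T μ ξ m < m * a
    rw [← ENNReal.ofReal_coe_nnreal, ENNReal.ofReal_lt_ofReal_iff_of_nonneg, div_lt_iff₀ hm']
      at hmH
    · linarith
    · refine div_nonneg (Finset.sum_nonneg fun w _ => Real.negMulLog_nonneg measureReal_nonneg
        measureReal_le_one) hm'.le
  have hp1 : ∑ w, (μ : Measure X).real (A w) = 1 := by
    rw [← measureReal_biUnion_finset]
    · have huniv : ⋃ w ∈ (Finset.univ : Finset (Fin m → Fin k)), A w = univ :=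
        eq_univ_of_forall fun x => mem_iUnion₂.2 ⟨orbitWord T ξ m x, Finset.mem_univ _, rfl⟩
      rw [huniv, probReal_univ]
    · intro v _ w _ hvw
      exact Disjoint.preimage _ (disjoint_singleton.2 hvw)
    · exact fun w _ => hAm w
  -- Nearby orbits may show words of `μ`-measure zero, so their information is measured by a
  -- positive `q`. The functional `f` is linear in the masses of the sets `A w`, whose boundaries
  -- are null, hence continuous at `μ`.
  obtain ⟨q, hq0, hq1, hq⟩ := exists_pos_crossEntropy_lt (fun w => measureReal_nonneg) hp1 hjoin
  let f : ProbabilityMeasure X → ℝ := fun ν =>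
    ∑ w, (ν : Measure X).real (A w) * -Real.log (q w)
  have hf : Tendsto f (𝓝 μ) (𝓝 (f μ)) := tendsto_finsetSum _ fun w _ => Tendsto.mul_const _ <|
    (ENNReal.tendsto_toReal (measure_ne_top _ _)).comp
      (ProbabilityMeasure.tendsto_measure_of_null_frontier_of_tendsto' tendsto_id (hAf w))
  refine ⟨{ν | f ν < m * a}, hf.eventually_lt_const hq, m * ((k : ℝ) ^ m * (k : ℝ) ^ m),
    fun n => ?_⟩
  obtain ⟨F, hF, hcard⟩ := exists_cover_of_information_le (T := T) hm hξd hq0 hq1 a (n + 1)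
  refine ⟨F, Subset.trans (fun x hx => ?_) hF, hcard⟩
  -- On an empirical measure, `f` is the orbit average of the information.
  have hfx : f (empiricalMeasure T x n) = ((n + 1 : ℕ) : ℝ)⁻¹ *
      ∑ j ∈ Finset.range (n + 1), -Real.log (q (orbitWord T ξ m (T^[j] x))) := by
    simp only [f, empiricalMeasure_real x n (hAm _), mul_assoc, Finset.sum_mul]
    rw [← Finset.mul_sum, Finset.sum_comm]
    congr 1
    refine Finset.sum_congr rfl fun j _ => ?_
    rw [Finset.sum_eq_single (orbitWord T ξ m (T^[j] x))]
    · simp [A]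
    · intro w _ hw
      rw [indicator_of_notMem, zero_mul]
      exact fun h => hw (Eq.symm h)
    · simp
  have hlt : f (empiricalMeasure T x n) < m * a := hx
  rw [hfx, inv_mul_lt_iff₀ (by positivity)] at hlt
  exact hlt.le

/-- Bowen's upper bound: if the empirical measures of every point of `Z` accumulate at some
invariant measure of entropy at most `t`, then `h_top(Z) ≤ t`. -/
theorem topEntropy_le_of_mapClusterPt [CompactSpace X] (hT : Continuous T) {Z : Set X} {t : ℝ≥0∞}
    (hZ : ∀ x ∈ Z, ∃ μ ∈ invariantMeasures T, MapClusterPt μ atTop (empiricalMeasure T x) ∧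
      measureEntropy T (μ : Measure X) ≤ t) : topEntropy T Z ≤ t := by
  refine iSup₂_le fun ε hε => le_of_forall_gt fun b hb => ?_
  obtain ⟨s, hts, hsb⟩ := ENNReal.lt_iff_exists_nnreal_btwn.1 hb
  obtain ⟨a, hta, has⟩ := ENNReal.lt_iff_exists_nnreal_btwn.1 hts
  refine lt_of_le_of_lt (iInf₂_le (f := fun (s : ℝ≥0) _ => (s : ℝ≥0∞)) s ?_) hsb
  let M : Set (ProbabilityMeasure X) :=
    {μ | μ ∈ invariantMeasures T ∧ measureEntropy T (μ : Measure X) ≤ t}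
  have hM : ∀ μ : ProbabilityMeasure X, ∃ U, μ ∈ M → U ∈ 𝓝 μ ∧ ∃ K : ℝ, ∀ n, ∃ F : Finset X,
      {x | empiricalMeasure T x n ∈ U} ⊆ (⋃ x ∈ F, bowenBall T (n + 1) x ε) ∧
      (F.card : ℝ) ≤ K * Real.exp (a * ((n + 1 : ℕ) : ℝ)) := by
    intro μ
    by_cases hμ : μ ∈ M
    · obtain ⟨U, hU, h⟩ := exists_nhds_cover hT hμ.1 (hμ.2.trans_lt hta) hε
      exact ⟨U, fun _ => ⟨hU, h⟩⟩
    · exact ⟨∅, fun h => (hμ h).elim⟩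
  choose U hU using hM
  -- `M` need not be compact, but a countable subcover is enough because countable unions preserve
  -- null sets.
  obtain ⟨D, hDM, hDc, hcov⟩ := TopologicalSpace.countable_cover_nhdsWithin (s := M)
    (f := fun μ => interior (U μ))
    fun μ hμ => mem_nhdsWithin_of_mem_nhds (interior_mem_nhds.2 (hU μ hμ).1)
  have := hDc.to_subtype
  have hnull : bowenMeasure T s
      (⋃ μ : D, {x | ∃ᶠ n in atTop, x ∈ {x | empiricalMeasure T x n ∈ U μ}}) ε = 0 := by
    refine bowenMeasure_iUnion_eq_zero fun μ => ?_
    obtain ⟨-, K, hK⟩ := hU μ (hDM μ.2)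
    exact bowenMeasure_frequently_eq_zero (by exact_mod_cast has) hK
  refine le_antisymm ((bowenMeasure_mono_set fun x hx => ?_).trans hnull.le) zero_le
  obtain ⟨μ, hμ, hcl, hμt⟩ := hZ x hx
  obtain ⟨ν, hν, hμν⟩ := mem_iUnion₂.1 (hcov ⟨hμ, hμt⟩)
  exact mem_iUnion.2 ⟨⟨ν, hν⟩, hcl.frequently (mem_interior_iff_mem_nhds.1 hμν)⟩

end LocalEstimate

/-! ### Limits of empirical measures and of Birkhoff averages -/

section Limits

variable {X : Type*} [MetricSpace X] [MeasurableSpace X] [BorelSpace X] {T : X → X}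

theorem integral_empiricalMeasure [CompactSpace X] {g : X → ℝ} (hg : Continuous g) (x : X)
    (n : ℕ) : ∫ y, g y ∂(empiricalMeasure T x n : Measure X) =
      ((n + 1 : ℕ) : ℝ)⁻¹ * ∑ j ∈ Finset.range (n + 1), g (T^[j] x) := by
  change ∫ y, g y ∂(((n + 1 : ℕ) : ℝ≥0∞)⁻¹ •
    ∑ j ∈ Finset.range (n + 1), Measure.dirac (T^[j] x)) = _
  rw [integral_smul_measure, integral_finsetSum_measure]
  · rw [ENNReal.toReal_inv, ENNReal.toReal_natCast, smul_eq_mul]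
    simp only [integral_dirac]
  · exact fun j _ => hg.integrable_of_hasCompactSupport (HasCompactSupport.of_compactSpace _)

/-- A limit of empirical measures along a subsequence is invariant. -/
theorem mem_invariantMeasures_of_tendsto [CompactSpace X] (hT : Continuous T) {x : X} {φ : ℕ → ℕ}
    (hφ : Tendsto φ atTop atTop) {μ : ProbabilityMeasure X}
    (hμ : Tendsto (fun n => empiricalMeasure T x (φ n)) atTop (𝓝 μ)) :
    μ ∈ invariantMeasures T := by
  refine ⟨hT.measurable, ?_⟩
  have : IsProbabilityMeasure ((μ : Measure X).map T) :=
    Measure.isProbabilityMeasure_map hT.measurable.aemeasurable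
  refine ext_of_forall_integral_eq_of_IsFiniteMeasure fun g => ?_
  rw [integral_map hT.measurable.aemeasurable g.continuous.aestronglyMeasurable]
  rw [ProbabilityMeasure.tendsto_iff_forall_integral_tendsto] at hμ
  have h1 := (hμ (g.compContinuous ⟨T, hT⟩)).sub (hμ g)
  have h2 : Tendsto (fun n =>
      ∫ y, g.compContinuous ⟨T, hT⟩ y ∂(empiricalMeasure T x (φ n) : Measure X) -
        ∫ y, g y ∂(empiricalMeasure T x (φ n) : Measure X)) atTop (𝓝 0) := by
    have h3 : Tendsto (fun n => ((φ n + 1 : ℕ) : ℝ)⁻¹ * (2 * ‖g‖)) atTop (𝓝 0) := by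
      have := (tendsto_inv_atTop_zero.comp (tendsto_natCast_atTop_atTop (R := ℝ))).comp
        ((tendsto_add_atTop_nat 1).comp hφ)
      simpa using this.mul_const (2 * ‖g‖)
    refine squeeze_zero_norm (fun n => ?_) h3
    rw [integral_empiricalMeasure (BoundedContinuousFunction.continuous _),
      integral_empiricalMeasure g.continuous, ← mul_sub, ← Finset.sum_sub_distrib, norm_mul,
      norm_inv, RCLike.norm_natCast]
    refine mul_le_mul_of_nonneg_left ?_ (by positivity)
    -- The sum telescopes to two boundary terms, which the factor `1 / (φ n + 1)` kills.
    have h4 : ∑ j ∈ Finset.range (φ n + 1), (g.compContinuous ⟨T, hT⟩ (T^[j] x) - g (T^[j] x)) =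
        g (T^[φ n + 1] x) - g x := by
      have := Finset.sum_range_sub (fun j => g (T^[j] x)) (φ n + 1)
      simpa [Function.iterate_succ_apply'] using this
    rw [h4, two_mul]
    exact (norm_sub_le _ _).trans (add_le_add (g.norm_coe_le_norm _) (g.norm_coe_le_norm _))
  exact sub_eq_zero.1 (tendsto_nhds_unique h1 h2)

/-- The empirical measures of every point accumulate at an invariant measure. -/
theorem exists_tendsto_empiricalMeasure [CompactSpace X] (hT : Continuous T) (x : X) :
    ∃ μ ∈ invariantMeasures T, ∃ φ : ℕ → ℕ, StrictMono φ ∧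
      Tendsto (fun n => empiricalMeasure T x (φ n)) atTop (𝓝 μ) := by
  obtain ⟨μ, -, φ, hφ, hμ⟩ := isCompact_univ.tendsto_subseq
    (x := empiricalMeasure T x) fun _ => mem_univ _
  exact ⟨μ, mem_invariantMeasures_of_tendsto hT hφ.tendsto_atTop hμ, φ, hφ, hμ⟩

variable {B : Type*} [NormedAddCommGroup B] [NormedSpace ℝ B]

/-- The shift to `n + 1` matters: the average of length `0` is `0`, which may lie outside the hull.
-/
theorem birkhoffAverage_mem_closedConvexHull {X : Type*} {T : X → X} {Φ : X → WeakDual ℝ B}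
    (x : X) (n : ℕ) :
    birkhoffAverage ℝ T Φ (n + 1) x ∈ closedConvexHull ℝ (range Φ) := by
  rw [birkhoffAverage, birkhoffSum, Finset.smul_sum]
  refine convex_closedConvexHull.sum_mem (fun _ _ => by positivity) ?_
    fun j _ => subset_closedConvexHull ⟨_, rfl⟩
  rw [Finset.sum_const, Finset.card_range, nsmul_eq_mul]
  exact mul_inv_cancel₀ (Nat.cast_ne_zero.2 n.succ_ne_zero)

/-- If empirical measures converge to `μ`, the Birkhoff averages converge to `∫ Φ dμ`. -/
theorem tendsto_birkhoffAverage_pettisIntegral [CompactSpace X] [CompleteSpace B]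
    {Φ : X → WeakDual ℝ B} (hΦ : Continuous Φ) {x : X} {φ : ℕ → ℕ} {μ : ProbabilityMeasure X}
    (hμ : Tendsto (fun n => empiricalMeasure T x (φ n)) atTop (𝓝 μ)) :
    Tendsto (fun n => birkhoffAverage ℝ T Φ (φ n + 1) x) atTop (𝓝 (pettisIntegral hΦ μ)) := by
  refine tendsto_iff_forall_eval_tendsto_topDualPairing.2 fun w => ?_
  rw [ProbabilityMeasure.tendsto_iff_forall_integral_tendsto] at hμ
  have h := hμ (BoundedContinuousFunction.mkOfCompact ⟨fun x => Φ x w, continuous_pairing hΦ w⟩)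
  refine h.congr fun n => ?_
  simp only [BoundedContinuousFunction.mkOfCompact_apply, ContinuousMap.coe_mk]
  rw [integral_empiricalMeasure (continuous_pairing hΦ w)]
  let ev : WeakDual ℝ B →ₗ[ℝ] ℝ :=
    { toFun := fun u => u w, map_add' := fun _ _ => rfl, map_smul' := fun _ _ => rfl }
  change _ = ev (birkhoffAverage ℝ T Φ (φ n + 1) x)
  rw [birkhoffAverage, birkhoffSum, map_smul, map_sum, smul_eq_mul]
  rfl

variable {Y : Type*} [TopologicalSpace Y] {Ψ : WeakDual ℝ B → Y} {Φ : X → WeakDual ℝ B} {β : Y}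

/-- The hull is closed and contains the averages, hence also `α`, so continuity of `Ψ` within the
hull suffices. -/
theorem tendsto_comp_birkhoffAverage {X : Type*} {T : X → X} {Φ : X → WeakDual ℝ B}
    (hΨ : ContinuousOn Ψ (closedConvexHull ℝ (range Φ))) {x : X} {φ : ℕ → ℕ} {α : WeakDual ℝ B}
    (hα : Tendsto (fun n => birkhoffAverage ℝ T Φ (φ n + 1) x) atTop (𝓝 α)) :
    Tendsto (fun n => Ψ (birkhoffAverage ℝ T Φ (φ n + 1) x)) atTop (𝓝 (Ψ α)) := by
  have hmem : α ∈ closedConvexHull ℝ (range Φ) := isClosed_closedConvexHull.mem_of_tendsto hα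
    (Eventually.of_forall fun n => birkhoffAverage_mem_closedConvexHull x _)
  exact (hΨ α hmem).tendsto.comp (tendsto_nhdsWithin_iff.2
    ⟨hα, Eventually.of_forall fun n => birkhoffAverage_mem_closedConvexHull x _⟩)

theorem limitLevelSet_subset_levelSet {X : Type*} {T : X → X} {Φ : X → WeakDual ℝ B}
    (hΨ : ContinuousOn Ψ (closedConvexHull ℝ (range Φ))) :
    limitLevelSet T Φ Ψ β ⊆ levelSet T Φ Ψ β := by
  rintro x ⟨α, hα, rfl⟩
  exact (tendsto_add_atTop_iff_nat 1).1
    (tendsto_comp_birkhoffAverage (φ := id) hΨ ((tendsto_add_atTop_iff_nat 1).2 hα))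

variable [CompactSpace X] [CompleteSpace B]

theorem genericPoints_subset_limitLevelSet {Y : Type*} {Ψ : WeakDual ℝ B → Y} {β : Y}
    (hΦ : Continuous Φ) {μ : ProbabilityMeasure X}
    (hμ : μ ∈ measureLevelSet T hΦ Ψ β) : genericPoints T μ ⊆ limitLevelSet T Φ Ψ β :=
  fun _ hx => ⟨pettisIntegral hΦ μ, (tendsto_add_atTop_iff_nat 1).1
    (tendsto_birkhoffAverage_pettisIntegral (φ := id) hΦ hx), hμ.2⟩

/-- Along a subsequence with empirical limit `μ`, the values of `Ψ` tend both to `Ψ (∫ Φ dμ)` and to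
`β`. -/
theorem exists_mem_measureLevelSet_mapClusterPt
    (hY : ∀ (u : ℕ → Y) (a b : Y), Tendsto u atTop (𝓝 a) → Tendsto u atTop (𝓝 b) → a = b)
    (hT : Continuous T) (hΦ : Continuous Φ)
    (hΨ : ContinuousOn Ψ (closedConvexHull ℝ (range Φ))) {x : X} (hx : x ∈ levelSet T Φ Ψ β) :
    ∃ μ ∈ measureLevelSet T hΦ Ψ β, MapClusterPt μ atTop (empiricalMeasure T x) := by
  obtain ⟨μ, hinv, φ, hφ, hμ⟩ := exists_tendsto_empiricalMeasure hT x
  refine ⟨μ, ⟨hinv, hY _ _ _ (tendsto_comp_birkhoffAverage hΨ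
    (tendsto_birkhoffAverage_pettisIntegral hΦ hμ)) ?_⟩, ?_⟩
  · exact hx.comp ((tendsto_add_atTop_nat 1).comp hφ.tendsto_atTop)
  · exact (hμ.mapClusterPt).of_comp hφ.tendsto_atTop

end Limits

end SaturatedSystem

end

/-- `WeakDual ℝ B` is the dual of `B` with the weak star topology. `Ψ` is a function on the closed
convex hull of `Φ(X)`, extended arbitrarily outside it: only its values on the hull occur, and
continuity is required of its restriction to the hull only. The hypothesis `hY` says that limits of
sequences in `Y` are unique, as the notation `lim Ψ(A_n Φ(x)) = β` presupposes; every Hausdorff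
space satisfies it. -/
theorem theorem3 {X : Type*} [MetricSpace X] [CompactSpace X] [MeasurableSpace X] [BorelSpace X]
    {B : Type*} [NormedAddCommGroup B] [NormedSpace ℝ B] [CompleteSpace B]
    {Y : Type*} [TopologicalSpace Y]
    (hY : ∀ (u : ℕ → Y) (a b : Y), Tendsto u atTop (𝓝 a) → Tendsto u atTop (𝓝 b) → a = b)
    (T : X → X) (hT : Continuous T) (hsat : SaturatedSystem.IsSaturated T)
    (Φ : X → WeakDual ℝ B) (hΦ : Continuous Φ)
    (Ψ : WeakDual ℝ B → Y) (hΨ : ContinuousOn Ψ (closedConvexHull ℝ (Set.range Φ)))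
    (β : Y) :
    (SaturatedSystem.measureLevelSet T hΦ Ψ β = ∅ →
      SaturatedSystem.levelSet T Φ Ψ β = ∅) ∧
    ((SaturatedSystem.measureLevelSet T hΦ Ψ β).Nonempty →
      SaturatedSystem.topEntropy T (SaturatedSystem.levelSet T Φ Ψ β) =
          SaturatedSystem.topEntropy T (SaturatedSystem.limitLevelSet T Φ Ψ β) ∧
      SaturatedSystem.topEntropy T (SaturatedSystem.limitLevelSet T Φ Ψ β) =
          ⨆ μ ∈ SaturatedSystem.measureLevelSet T hΦ Ψ β,
            SaturatedSystem.measureEntropy T (μ : Measure X)) := by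
  have hle : SaturatedSystem.topEntropy T (SaturatedSystem.levelSet T Φ Ψ β) ≤
      ⨆ μ ∈ SaturatedSystem.measureLevelSet T hΦ Ψ β,
        SaturatedSystem.measureEntropy T (μ : Measure X) :=
    SaturatedSystem.topEntropy_le_of_mapClusterPt hT fun x hx => by
      obtain ⟨μ, hμ, hcl⟩ :=
        SaturatedSystem.exists_mem_measureLevelSet_mapClusterPt hY hT hΦ hΨ hx
      exact ⟨μ, hμ.1, hcl, le_iSup₂_of_le μ hμ le_rfl⟩
  have hge : ⨆ μ ∈ SaturatedSystem.measureLevelSet T hΦ Ψ β,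
      SaturatedSystem.measureEntropy T (μ : Measure X) ≤
        SaturatedSystem.topEntropy T (SaturatedSystem.limitLevelSet T Φ Ψ β) :=
    -- Saturation enters only here.
    iSup₂_le fun μ hμ => (hsat μ hμ.1).symm.le.trans
      (SaturatedSystem.topEntropy_mono (SaturatedSystem.genericPoints_subset_limitLevelSet hΦ hμ))
  have hmono : SaturatedSystem.topEntropy T (SaturatedSystem.limitLevelSet T Φ Ψ β) ≤
      SaturatedSystem.topEntropy T (SaturatedSystem.levelSet T Φ Ψ β) :=
    SaturatedSystem.topEntropy_mono (SaturatedSystem.limitLevelSet_subset_levelSet hΨ)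
  refine ⟨fun h => eq_empty_of_forall_notMem fun x hx => ?_, fun _ =>
    ⟨le_antisymm (hle.trans hge) hmono, le_antisymm (hmono.trans hle) hge⟩⟩
  obtain ⟨μ, hμ, -⟩ := SaturatedSystem.exists_mem_measureLevelSet_mapClusterPt hY hT hΦ hΨ hx
  exact (h ▸ hμ : μ ∈ (∅ : Set (ProbabilityMeasure X)))
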